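/- For $\alpha>0$ and $t\ge 0$ let $\Lambda_t$ be the linear map on $M_2(\mathbb C)$ determined by $$\Lambda_t\Big[\tfrac12\big(r_0\mathbb I+r_1\sigma_1+r_2\sigma_2+r_3\sigma_3\big)\Big]=\tfrac12\Big(r_0\mathbb I+e^{-\alpha t}\cosh^{\alpha}(t)\,(r_1\sigma_1+r_2\sigma_2)+e^{-2\alpha t}r_3\sigma_3\Big),$$ where $\sigma_1,\sigma_2,\sigma_3$ are the Pauli matrices. A linear map on matrices is positive if it sends positive semidefinite matrices to positive semidefinite matrices, and completely positive if its tensor product with the identity map of $M_k(\mathbb C)$ is positive for every $k$. For a family $\{\Phi_t\}_{t\ge0}$ of linear maps on matrices and density matrices $\varrho_1,\varrho_2$, the information flow at time $t$ is $\sigma(\varrho_1,\varrho_2;t)=\frac{d}{dt}\|\Phi_t[\varrho_1-\varrho_2]\|_1$, where $\|\cdot\|_1$ is the trace norm (the right derivative is taken at $t=0$). Let $\alpha\in[\frac12,1)$. Then: 1. $\Lambda_t$ is positive for every $t\ge0$, and is not completely positive for any $t>0$. 2. $\Lambda_t$ is P-divisible: every $\Lambda_s$, $s\ge 0$, is invertible,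 and for all $t\ge s\ge0$ the map $\Lambda_{t,s}=\Lambda_t\Lambda_s^{-1}$ (the unique one with $\Lambda_t=\Lambda_{t,s}\Lambda_s$) is positive. 3. $\Lambda_t\otimes\Lambda_t$ is positive for every $t\ge0$. 4. The maps $\Lambda_{t,s}\otimes\Lambda_{t,s}$ are not positive for all $t>s\ge0$, i.e. there exist $t>s\ge0$ for which $\Lambda_{t,s}\otimes\Lambda_{t,s}$ is not positive. 5. (Superactivation of back-flow of information.) For the family $\Lambda_t$, the information flow exists and satisfies $\sigma(\varrho_1,\varrho_2;t)\le0$ for all qubit density matrices $\varrho_1,\varrho_2$ and all $t\ge0$; but for the family $\Lambda_t\otimes\Lambda_t$ there are two-qubit density matrices $\varrho_1,\varrho_2$ and a time $t\ge0$ at which the information flow exists and $\sigma(\varrho_1,\varrho_2;t)>0$. -/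

import Mathlib

open scoped Kronecker ComplexOrder

/-- A linear map between matrix algebras is positive if it sends positive semidefinite matrices
to positive semidefinite matrices. -/
def IsPositiveMap {m n : Type*} (Φ : Matrix m m ℂ →ₗ[ℂ] Matrix n n ℂ) : Prop :=
  ∀ X : Matrix m m ℂ, X.PosSemidef → (Φ X).PosSemidef

/-- The tensor product `Φ ⊗ Ψ` of two linear maps of matrix algebras, acting on
`M_m(ℂ) ⊗ M_n(ℂ) = M_{m × n}(ℂ)` by linear extension of
`E_ij ⊗ E_kl ↦ Φ(E_ij) ⊗ Ψ(E_kl)` from the matrix units. -/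
noncomputable def tensorMap {m n : Type*} [Fintype m] [DecidableEq m] [Fintype n] [DecidableEq n]
    (Φ : Matrix m m ℂ →ₗ[ℂ] Matrix m m ℂ) (Ψ : Matrix n n ℂ →ₗ[ℂ] Matrix n n ℂ) :
    Matrix (m × n) (m × n) ℂ →ₗ[ℂ] Matrix (m × n) (m × n) ℂ where
  toFun X := ∑ i, ∑ j, ∑ k, ∑ l,
    X (i, k) (j, l) • (Φ (Matrix.single i j 1) ⊗ₖ Ψ (Matrix.single k l 1))
  map_add' X Y := by
    simp only [Matrix.add_apply, add_smul, Finset.sum_add_distrib]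
  map_smul' c X := by
    simp only [Matrix.smul_apply, smul_eq_mul, mul_smul, Finset.smul_sum, RingHom.id_apply]

/-- The defining property of the tensor product of maps. -/
theorem tensorMap_kronecker {m n : Type*} [Fintype m] [DecidableEq m] [Fintype n] [DecidableEq n]
    (Φ : Matrix m m ℂ →ₗ[ℂ] Matrix m m ℂ) (Ψ : Matrix n n ℂ →ₗ[ℂ] Matrix n n ℂ)
    (A : Matrix m m ℂ) (B : Matrix n n ℂ) :
    tensorMap Φ Ψ (A ⊗ₖ B) = Φ A ⊗ₖ Ψ B := by
  have hA : Φ A = ∑ i, ∑ j, A i j • Φ (Matrix.single i j 1) := by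
    conv_lhs => rw [Matrix.matrix_eq_sum_single A]
    simp only [map_sum]
    refine Finset.sum_congr rfl fun i _ => Finset.sum_congr rfl fun j _ => ?_
    rw [← LinearMap.map_smul, Matrix.smul_single, smul_eq_mul, mul_one]
  have hB : Ψ B = ∑ k, ∑ l, B k l • Ψ (Matrix.single k l 1) := by
    conv_lhs => rw [Matrix.matrix_eq_sum_single B]
    simp only [map_sum]
    refine Finset.sum_congr rfl fun k _ => Finset.sum_congr rfl fun l _ => ?_
    rw [← LinearMap.map_smul, Matrix.smul_single, smul_eq_mul, mul_one]
  rw [hA, hB]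
  ext ⟨a, b⟩ ⟨c, d⟩
  simp only [tensorMap, LinearMap.coe_mk, AddHom.coe_mk, Matrix.kroneckerMap_apply,
    Matrix.sum_apply, Matrix.smul_apply, smul_eq_mul, Finset.sum_mul]
  simp only [Finset.mul_sum]
  refine Finset.sum_congr rfl fun i _ => Finset.sum_congr rfl fun j _ =>
    Finset.sum_congr rfl fun k _ => Finset.sum_congr rfl fun l _ => ?_
  ring

/-- Complete positivity: `Φ ⊗ id_k` is positive for every `k`. -/
def IsCompletelyPositiveMap {n : Type*} [Fintype n] [DecidableEq n]
    (Φ : Matrix n n ℂ →ₗ[ℂ] Matrix n n ℂ) : Prop :=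
  ∀ k : ℕ, IsPositiveMap
    (tensorMap Φ (LinearMap.id : Matrix (Fin k) (Fin k) ℂ →ₗ[ℂ] Matrix (Fin k) (Fin k) ℂ))

/-- The intertwining map `Λ_{t,s} = Λ_t ∘ Λ_s⁻¹` of a family of maps; it is meaningful when
`Λ_s` is invertible, and is then the only map with `Λ_t = Λ_{t,s} ∘ Λ_s`. -/
noncomputable def propagator {n : Type*}
    (Φ : ℝ → Module.End ℂ (Matrix n n ℂ)) (t s : ℝ) : Module.End ℂ (Matrix n n ℂ) :=
  Φ t * Ring.inverse (Φ s)

/-- The Pauli matrix `σ₁`. -/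
def pauli1 : Matrix (Fin 2) (Fin 2) ℂ := !![0, 1; 1, 0]

/-- The Pauli matrix `σ₂`. -/
def pauli2 : Matrix (Fin 2) (Fin 2) ℂ := !![0, -Complex.I; Complex.I, 0]

/-- The Pauli matrix `σ₃`. -/
def pauli3 : Matrix (Fin 2) (Fin 2) ℂ := !![1, 0; 0, -1]

/-- The `ℂ`-linear functional `X ↦ Tr (σ X)`; for `σ = σ_j` it gives the `j`-th Bloch
component `r_j` of `X`. -/
noncomputable def pairing (σ : Matrix (Fin 2) (Fin 2) ℂ) :
    Matrix (Fin 2) (Fin 2) ℂ →ₗ[ℂ] ℂ :=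
  (Matrix.traceLinearMap (Fin 2) ℂ ℂ) ∘ₗ (LinearMap.mulLeft ℂ σ)

/-- The linear map of `M₂(ℂ)` with
`½(r₀ 1 + r₁σ₁ + r₂σ₂ + r₃σ₃) ↦
½(r₀ 1 + e^{-αt} (cosh t)^α (r₁σ₁ + r₂σ₂) + e^{-2αt} r₃σ₃)`. -/
noncomputable def qubitMap (α t : ℝ) :
    Module.End ℂ (Matrix (Fin 2) (Fin 2) ℂ) :=
  (1 / 2 : ℂ) •
    ((Matrix.traceLinearMap (Fin 2) ℂ ℂ).smulRight 1 +
      ((Real.exp (-α * t) * Real.cosh t ^ α : ℝ) : ℂ) •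
        ((pairing pauli1).smulRight pauli1 + (pairing pauli2).smulRight pauli2) +
      ((Real.exp (-2 * α * t) : ℝ) : ℂ) • (pairing pauli3).smulRight pauli3)

/-- Density matrices. -/
def IsDensityMatrix {n : Type*} [Fintype n] (ρ : Matrix n n ℂ) : Prop :=
  ρ.PosSemidef ∧ ρ.trace = 1

/-- The trace norm `‖X‖₁`: the sum of the singular values, i.e. of the square roots of the
eigenvalues of `Xᴴ X`. -/
noncomputable def traceNorm {n : Type*} [Fintype n] [DecidableEq n] (X : Matrix n n ℂ) : ℝ :=
  ∑ i, Real.sqrt ((Matrix.isHermitian_conjTranspose_mul_self X).eigenvalues i)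

/-- `v` is the information flow `d/dt ‖Φ_t[ρ₁ - ρ₂]‖₁` at the time `t`, for a family `Φ` indexed
by times `t ≥ 0` (so it is the right derivative at `t = 0`). -/
def HasInformationFlow {n : Type*} [Fintype n] [DecidableEq n]
    (Φ : ℝ → Module.End ℂ (Matrix n n ℂ)) (ρ₁ ρ₂ : Matrix n n ℂ) (t v : ℝ) : Prop :=
  HasDerivWithinAt (fun τ => traceNorm (Φ τ (ρ₁ - ρ₂))) v (Set.Ici 0) t

/-! Put x = e^{-2t}. Then `qubitMap α t` is `axialMap a b` with a = ((1+x)/2)^α and b = x^α, and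
axial maps compose by multiplying parameters, so each propagator is axial too. Positivity and
P-divisibility follow because a and b are positive, decreasing and equal to 1 at time 0
(`isPositiveMap_axialMap`).

The other map properties rest on a test with the Bell projection and on Jensen's inequality at the
points 1 and x. Complete positivity would force 2a ≤ 1 + b, which strict concavity of the α-th power
forbids. For the tensor square the test forces 2a² ≤ 1 + b². This bound is also sufficient, by an
explicit decomposition (`isPositiveMap_tensorMap_axialMap_of_eq`), and convexity of the 2α-th power
supplies it. Late propagators violate it: a has nearly stopped moving while b still decays
exponentially.

The same disparity of rates produces the back-flow. For one qubit the trace norm is twice the length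
of a shrinking Bloch vector. For two qubits, a suitable traceless difference has one negative
eigenvalue, and the decay of b pushes it further down. -/

theorem IsPositiveMap.comp {n : Type*} {Φ Ψ : Matrix n n ℂ →ₗ[ℂ] Matrix n n ℂ} (hΦ : IsPositiveMap Φ)
    (hΨ : IsPositiveMap Ψ) : IsPositiveMap (Φ ∘ₗ Ψ) :=
  fun X hX => hΦ _ (hΨ X hX)

theorem IsPositiveMap.add {n : Type*} {Φ Ψ : Matrix n n ℂ →ₗ[ℂ] Matrix n n ℂ} (hΦ : IsPositiveMap Φ)
    (hΨ : IsPositiveMap Ψ) : IsPositiveMap (Φ + Ψ) :=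
  fun X hX => (hΦ X hX).add (hΨ X hX)

theorem IsPositiveMap.smul {n : Type*} {Φ : Matrix n n ℂ →ₗ[ℂ] Matrix n n ℂ} (hΦ : IsPositiveMap Φ)
    {r : ℝ} (hr : 0 ≤ r) : IsPositiveMap ((r : ℂ) • Φ) :=
  fun X hX => (hΦ X hX).smul (Complex.zero_le_real.2 hr)

/-! ### Tensor products of congruences and of transposed congruences -/

section TensorMap

variable {m n : Type*} [Fintype m] [DecidableEq m] [Fintype n] [DecidableEq n]

/-- Linear maps on `M_{m × n}(ℂ)` are determined by their values on Kronecker products. -/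
theorem linearMap_ext_kronecker {E : Type*} [AddCommMonoid E] [Module ℂ E]
    {f g : Matrix (m × n) (m × n) ℂ →ₗ[ℂ] E}
    (h : ∀ (A : Matrix m m ℂ) (B : Matrix n n ℂ), f (A ⊗ₖ B) = g (A ⊗ₖ B)) : f = g := by
  refine Matrix.ext_linearMap (R := ℂ) fun p q => LinearMap.ext_ring ?_
  have := h (Matrix.single p.1 q.1 1) (Matrix.single p.2 q.2 1)
  rw [Matrix.single_kronecker_single] at this
  simpa using this

theorem tensorMap_add_left (Φ Φ' : Matrix m m ℂ →ₗ[ℂ] Matrix m m ℂ)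
    (Ψ : Matrix n n ℂ →ₗ[ℂ] Matrix n n ℂ) :
    tensorMap (Φ + Φ') Ψ = tensorMap Φ Ψ + tensorMap Φ' Ψ :=
  linearMap_ext_kronecker fun A B => by
    simp [tensorMap_kronecker, Matrix.add_kronecker]

theorem tensorMap_add_right (Φ : Matrix m m ℂ →ₗ[ℂ] Matrix m m ℂ)
    (Ψ Ψ' : Matrix n n ℂ →ₗ[ℂ] Matrix n n ℂ) :
    tensorMap Φ (Ψ + Ψ') = tensorMap Φ Ψ + tensorMap Φ Ψ' :=
  linearMap_ext_kronecker fun A B => by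
    simp [tensorMap_kronecker, Matrix.kronecker_add]

theorem tensorMap_smul_left (r : ℂ) (Φ : Matrix m m ℂ →ₗ[ℂ] Matrix m m ℂ)
    (Ψ : Matrix n n ℂ →ₗ[ℂ] Matrix n n ℂ) :
    tensorMap (r • Φ) Ψ = r • tensorMap Φ Ψ :=
  linearMap_ext_kronecker fun A B => by
    simp [tensorMap_kronecker, Matrix.smul_kronecker]

theorem tensorMap_smul_right (r : ℂ) (Φ : Matrix m m ℂ →ₗ[ℂ] Matrix m m ℂ)
    (Ψ : Matrix n n ℂ →ₗ[ℂ] Matrix n n ℂ) :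
    tensorMap Φ (r • Ψ) = r • tensorMap Φ Ψ :=
  linearMap_ext_kronecker fun A B => by
    simp [tensorMap_kronecker, Matrix.kronecker_smul]

theorem tensorMap_mul (Φ Φ' : Module.End ℂ (Matrix m m ℂ)) (Ψ Ψ' : Module.End ℂ (Matrix n n ℂ)) :
    tensorMap (Φ * Φ') (Ψ * Ψ') = tensorMap Φ Ψ ∘ₗ tensorMap Φ' Ψ' :=
  linearMap_ext_kronecker fun A B => by
    simp [tensorMap_kronecker]

/-- The congruence `X ↦ V X Vᴴ`. -/
noncomputable def congrMap (V : Matrix n n ℂ) : Module.End ℂ (Matrix n n ℂ) :=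
  LinearMap.mulRight ℂ V.conjTranspose ∘ₗ LinearMap.mulLeft ℂ V

/-- The transposed congruence `X ↦ V Xᵀ Vᴴ`. -/
noncomputable def cocongrMap (V : Matrix n n ℂ) : Module.End ℂ (Matrix n n ℂ) :=
  congrMap V ∘ₗ (Matrix.transposeLinearEquiv n n ℂ ℂ).toLinearMap

theorem congrMap_apply (V X : Matrix n n ℂ) : congrMap V X = V * X * V.conjTranspose := rfl

theorem cocongrMap_apply (V X : Matrix n n ℂ) :
    cocongrMap V X = V * X.transpose * V.conjTranspose := rfl

theorem isPositiveMap_congrMap (V : Matrix n n ℂ) : IsPositiveMap (congrMap V) :=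
  fun _ hX => hX.mul_mul_conjTranspose_same V

theorem isPositiveMap_cocongrMap (V : Matrix n n ℂ) : IsPositiveMap (cocongrMap V) :=
  fun _ hX => hX.transpose.mul_mul_conjTranspose_same V

theorem isPositiveMap_tensorMap_congrMap (V : Matrix m m ℂ) (W : Matrix n n ℂ) :
    IsPositiveMap (tensorMap (congrMap V) (congrMap W)) := by
  have : tensorMap (congrMap V) (congrMap W) = congrMap (V ⊗ₖ W) :=
    linearMap_ext_kronecker fun A B => by
      simp [tensorMap_kronecker, congrMap_apply, Matrix.mul_kronecker_mul,
        Matrix.conjTranspose_kronecker]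
  rw [this]
  exact isPositiveMap_congrMap _

theorem isPositiveMap_tensorMap_cocongrMap (V : Matrix m m ℂ) (W : Matrix n n ℂ) :
    IsPositiveMap (tensorMap (cocongrMap V) (cocongrMap W)) := by
  have : tensorMap (cocongrMap V) (cocongrMap W) = cocongrMap (V ⊗ₖ W) :=
    linearMap_ext_kronecker fun A B => by
      rw [tensorMap_kronecker, cocongrMap_apply, cocongrMap_apply, cocongrMap_apply,
        Matrix.mul_kronecker_mul, Matrix.mul_kronecker_mul, Matrix.conjTranspose_kronecker]
      rfl
  rw [this]
  exact isPositiveMap_cocongrMap _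

end TensorMap

/-! ### Axial qubit maps and their composition -/

/-- The unital qubit map `½(r₀ 1 + r₁σ₁ + r₂σ₂ + r₃σ₃) ↦ ½(r₀ 1 + a (r₁σ₁ + r₂σ₂) + b r₃σ₃)`,
in matrix entries. -/
noncomputable def axialMap (a b : ℝ) : Module.End ℂ (Matrix (Fin 2) (Fin 2) ℂ) where
  toFun X := !![(1 + b) / 2 * X 0 0 + (1 - b) / 2 * X 1 1, a * X 0 1;
    a * X 1 0, (1 + b) / 2 * X 1 1 + (1 - b) / 2 * X 0 0]
  map_add' X Y := by
    ext i j; fin_cases i <;> fin_cases j <;> simp <;> ring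
  map_smul' r X := by
    ext i j; fin_cases i <;> fin_cases j <;> simp <;> ring

theorem axialMap_apply (a b : ℝ) (X : Matrix (Fin 2) (Fin 2) ℂ) :
    axialMap a b X = !![(1 + b) / 2 * X 0 0 + (1 - b) / 2 * X 1 1, a * X 0 1;
      a * X 1 0, (1 + b) / 2 * X 1 1 + (1 - b) / 2 * X 0 0] := rfl

theorem axialMap_mul (a b a' b' : ℝ) :
    axialMap a b * axialMap a' b' = axialMap (a * a') (b * b') := by
  ext X i j
  fin_cases i <;> fin_cases j <;> simp [axialMap_apply] <;> ring

theorem axialMap_one : axialMap 1 1 = 1 := by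
  ext X i j
  fin_cases i <;> fin_cases j <;> simp [axialMap_apply]

theorem isUnit_axialMap {a b : ℝ} (ha : a ≠ 0) (hb : b ≠ 0) : IsUnit (axialMap a b) := by
  refine IsUnit.of_mul_eq_one (axialMap a⁻¹ b⁻¹) ?_
  rw [axialMap_mul, mul_inv_cancel₀ ha, mul_inv_cancel₀ hb, axialMap_one]

theorem axialMap_mul_inverse {a b a' b' : ℝ} (ha : a' ≠ 0) (hb : b' ≠ 0) :
    axialMap a b * Ring.inverse (axialMap a' b') = axialMap (a / a') (b / b') := by
  have h : axialMap a b = axialMap (a / a') (b / b') * axialMap a' b' := by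
    rw [axialMap_mul, div_mul_cancel₀ _ ha, div_mul_cancel₀ _ hb]
  rw [h, mul_assoc, Ring.mul_inverse_cancel _ (isUnit_axialMap ha hb), mul_one]

theorem qubitMap_eq_axialMap (α t : ℝ) :
    qubitMap α t =
      axialMap (Real.exp (-α * t) * Real.cosh t ^ α) (Real.exp (-2 * α * t)) := by
  unfold qubitMap
  generalize Real.exp (-α * t) * Real.cosh t ^ α = a
  generalize Real.exp (-2 * α * t) = b
  have hI := Complex.I_mul_I
  ext X i j
  fin_cases i <;> fin_cases j <;>
    simp only [axialMap_apply, pairing, Matrix.trace_fin_two, LinearMap.smul_apply,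
      LinearMap.add_apply, LinearMap.smulRight_apply, LinearMap.comp_apply,
      LinearMap.mulLeft_apply, Matrix.traceLinearMap_apply, Matrix.smul_apply, Matrix.add_apply,
      Matrix.mul_apply, Fin.sum_univ_two] <;>
    simp [pauli1, pauli2, pauli3] <;> grind

/-! ### Decompositions into congruences; positivity of the tensor square -/

/-- The part of the diagonal that stays in place. -/
noncomputable def diagPart : Module.End ℂ (Matrix (Fin 2) (Fin 2) ℂ) :=
  congrMap (Matrix.single 0 0 1) + congrMap (Matrix.single 1 1 1)

/-- The diagonal with its two entries exchanged. -/
noncomputable def diagSwap : Module.End ℂ (Matrix (Fin 2) (Fin 2) ℂ) :=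
  congrMap (Matrix.single 0 1 1) + congrMap (Matrix.single 1 0 1)

/-- The off-diagonal part. -/
noncomputable def offDiagPart : Module.End ℂ (Matrix (Fin 2) (Fin 2) ℂ) :=
  congrMap 1 - diagPart

theorem diagPart_apply (X : Matrix (Fin 2) (Fin 2) ℂ) :
    diagPart X = !![X 0 0, 0; 0, X 1 1] := by
  ext i j
  fin_cases i <;> fin_cases j <;>
    simp [diagPart, congrMap_apply]

theorem diagSwap_apply (X : Matrix (Fin 2) (Fin 2) ℂ) :
    diagSwap X = !![X 1 1, 0; 0, X 0 0] := by
  ext i j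
  fin_cases i <;> fin_cases j <;>
    simp [diagSwap, congrMap_apply]

theorem offDiagPart_apply (X : Matrix (Fin 2) (Fin 2) ℂ) :
    offDiagPart X = !![0, X 0 1; X 1 0, 0] := by
  ext i j
  fin_cases i <;> fin_cases j <;>
    simp [offDiagPart, diagPart_apply, congrMap_apply]

theorem congrMap_one_eq : congrMap (1 : Matrix (Fin 2) (Fin 2) ℂ) = diagPart + offDiagPart := by
  simp [offDiagPart]

theorem cocongrMap_pauli1_eq : cocongrMap pauli1 = diagSwap + offDiagPart := by
  ext X i j
  fin_cases i <;> fin_cases j <;>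
    simp [cocongrMap_apply, Matrix.mul_apply, Fin.sum_univ_two, diagSwap_apply,
      offDiagPart_apply] <;> simp [pauli1]

/-- Transposition does not affect diagonal entries. Hence the diagonal part may be tensored with
either kind of congruence without losing positivity. -/
theorem diagPart_eq_cocongrMap :
    diagPart = cocongrMap (Matrix.single 0 0 1) + cocongrMap (Matrix.single 1 1 1) := by
  ext X i j
  fin_cases i <;> fin_cases j <;>
    simp [cocongrMap_apply, diagPart_apply]

theorem axialMap_eq_combination (a b : ℝ) :
    axialMap a b = (((1 + b) / 2 : ℝ) : ℂ) • diagPart + (((1 - b) / 2 : ℝ) : ℂ) • diagSwap +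
      (a : ℂ) • offDiagPart := by
  ext X i j
  fin_cases i <;> fin_cases j <;>
    simp [axialMap_apply, diagPart_apply, diagSwap_apply, offDiagPart_apply]

theorem dephasing_eq_combination (a : ℝ) :
    axialMap a 1 = (((1 + a) / 2 : ℝ) : ℂ) • congrMap 1 + (((1 - a) / 2 : ℝ) : ℂ) • congrMap pauli3 := by
  ext X i j
  fin_cases i <;> fin_cases j <;>
    simp [axialMap_apply, congrMap_apply, Matrix.mul_apply, Fin.sum_univ_two] <;>
    simp [pauli3] <;> ring

/-- Dephasing takes care of a. What remains mixes the identity with X ↦ σ₁ Xᵀ σ₁; both keep the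
off-diagonal entries, and only the second exchanges the diagonal ones. -/
theorem isPositiveMap_axialMap {a b : ℝ} (ha : 0 ≤ a) (ha' : a ≤ 1) (hb : 0 ≤ b) (hb' : b ≤ 1) :
    IsPositiveMap (axialMap a b) := by
  have h : axialMap a b = ((((1 + b) / 2 : ℝ) : ℂ) • congrMap 1 +
      (((1 - b) / 2 : ℝ) : ℂ) • cocongrMap pauli1) ∘ₗ axialMap a 1 := by
    rw [congrMap_one_eq, cocongrMap_pauli1_eq]
    ext X i j
    fin_cases i <;> fin_cases j <;>
      simp [axialMap_apply, diagPart_apply, diagSwap_apply, offDiagPart_apply] <;> ring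
  rw [h, dephasing_eq_combination]
  have hb1 : 0 ≤ (1 + b) / 2 := by linarith
  have hb2 : 0 ≤ (1 - b) / 2 := by linarith
  have ha1 : 0 ≤ (1 + a) / 2 := by linarith
  have ha2 : 0 ≤ (1 - a) / 2 := by linarith
  exact (((isPositiveMap_congrMap _).smul hb1).add ((isPositiveMap_cocongrMap _).smul hb2)).comp
    (((isPositiveMap_congrMap _).smul ha1).add ((isPositiveMap_congrMap _).smul ha2))

theorem isPositiveMap_tensorMap_dephasing {a : ℝ} (ha : 0 ≤ a) (ha' : a ≤ 1) :
    IsPositiveMap (tensorMap (axialMap a 1) (axialMap a 1)) := by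
  have ha1 : 0 ≤ (1 + a) / 2 := by linarith
  have ha2 : 0 ≤ (1 - a) / 2 := by linarith
  have h (V : Matrix (Fin 2) (Fin 2) ℂ) :
      IsPositiveMap (tensorMap (congrMap V) (axialMap a 1)) := by
    rw [dephasing_eq_combination, tensorMap_add_right, tensorMap_smul_right, tensorMap_smul_right]
    exact ((isPositiveMap_tensorMap_congrMap _ _).smul ha1).add
      ((isPositiveMap_tensorMap_congrMap _ _).smul ha2)
  have e : tensorMap (axialMap a 1) (axialMap a 1) =
      (((1 + a) / 2 : ℝ) : ℂ) • tensorMap (congrMap 1) (axialMap a 1) +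
      (((1 - a) / 2 : ℝ) : ℂ) • tensorMap (congrMap pauli3) (axialMap a 1) := by
    conv_lhs => rw [dephasing_eq_combination a, tensorMap_add_left, tensorMap_smul_left,
      tensorMap_smul_left, ← dephasing_eq_combination a]
  rw [e]
  exact ((h _).smul ha1).add ((h _).smul ha2)

/-- The extremal case: the tensor square is a sum of a completely positive map and a completely
positive map composed with the transposition. -/
theorem isPositiveMap_tensorMap_axialMap_of_eq {a b : ℝ} (ha : 0 ≤ a) (hb : 0 ≤ b) (hb' : b ≤ 1)
    (hab : 2 * a ^ 2 = 1 + b ^ 2) :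
    IsPositiveMap (tensorMap (axialMap a b) (axialMap a b)) := by
  obtain ⟨c, hc⟩ : ∃ c, c = (1 + b) / 2 := ⟨_, rfl⟩
  obtain ⟨d, hd⟩ : ∃ d, d = (1 - b) / 2 := ⟨_, rfl⟩
  have hcd : a ^ 2 = c ^ 2 + d ^ 2 := by rw [hc, hd]; linarith
  have hc0 : 0 ≤ c := by rw [hc]; linarith
  have hd0 : 0 ≤ d := by rw [hd]; linarith
  have hca : c ≤ a := by nlinarith
  have hda : d ≤ a := by nlinarith
  have ha1 : a ≤ 1 := by nlinarith
  -- Since c + d = 1 and a² = c² + d², the right-hand side equals (1 - a)²/2.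
  have hrest : 0 ≤ c * d - c * (a - c) - d * (a - d) := by nlinarith
  have hX : IsPositiveMap (tensorMap diagPart (cocongrMap pauli1)) := by
    rw [diagPart_eq_cocongrMap, tensorMap_add_left]
    exact (isPositiveMap_tensorMap_cocongrMap _ _).add (isPositiveMap_tensorMap_cocongrMap _ _)
  have hX' : IsPositiveMap (tensorMap (cocongrMap pauli1) diagPart) := by
    rw [diagPart_eq_cocongrMap, tensorMap_add_right]
    exact (isPositiveMap_tensorMap_cocongrMap _ _).add (isPositiveMap_tensorMap_cocongrMap _ _)
  have hF (V : Matrix (Fin 2) (Fin 2) ℂ) : IsPositiveMap (tensorMap diagSwap (congrMap V)) := by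
    rw [diagSwap, tensorMap_add_left]
    exact (isPositiveMap_tensorMap_congrMap _ _).add (isPositiveMap_tensorMap_congrMap _ _)
  have hF' (V : Matrix (Fin 2) (Fin 2) ℂ) : IsPositiveMap (tensorMap (congrMap V) diagSwap) := by
    rw [diagSwap, tensorMap_add_right]
    exact (isPositiveMap_tensorMap_congrMap _ _).add (isPositiveMap_tensorMap_congrMap _ _)
  have hFD : IsPositiveMap (tensorMap diagSwap diagPart) := by
    rw [diagPart, tensorMap_add_right]
    exact (hF _).add (hF _)
  have hDF : IsPositiveMap (tensorMap diagPart diagSwap) := by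
    rw [diagPart, tensorMap_add_left]
    exact (hF' _).add (hF' _)
  -- Write D, F, O for the diagonal, swapped and off-diagonal parts. The first two terms give O ⊗ O
  -- the coefficient c² + d² = a². The next two raise the mixed terms with O to ca and da, and the
  -- last fills the coefficient of D ⊗ F and F ⊗ D up to cd.
  have key := ((((isPositiveMap_tensorMap_congrMap (1 : Matrix (Fin 2) (Fin 2) ℂ)
      (1 : Matrix (Fin 2) (Fin 2) ℂ)).smul (sq_nonneg c)).add
    ((isPositiveMap_tensorMap_cocongrMap pauli1 pauli1).smul (sq_nonneg d))).add
    ((hX.add hX').smul (mul_nonneg hc0 (sub_nonneg.2 hca)))).add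
    (((hF 1).add (hF' 1)).smul (mul_nonneg hd0 (sub_nonneg.2 hda))) |>.add
    ((hFD.add hDF).smul hrest)
  convert key using 1
  have hcd' : (a : ℂ) ^ 2 = c ^ 2 + d ^ 2 := by exact_mod_cast hcd
  rw [axialMap_eq_combination, ← hc, ← hd, congrMap_one_eq, cocongrMap_pauli1_eq]
  simp only [tensorMap_add_left, tensorMap_add_right, tensorMap_smul_left, tensorMap_smul_right]
  match_scalars <;> first | ring1 | linear_combination hcd'

/-- A smaller a is reached from the extremal value by dephasing first, and the tensor square of
dephasing is a mixture of congruences. -/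
theorem isPositiveMap_tensorMap_axialMap {a b : ℝ} (ha : 0 ≤ a) (hb : 0 ≤ b) (hb' : b ≤ 1)
    (hab : 2 * a ^ 2 ≤ 1 + b ^ 2) :
    IsPositiveMap (tensorMap (axialMap a b) (axialMap a b)) := by
  set r := Real.sqrt ((1 + b ^ 2) / 2) with hr
  have hr2 : r ^ 2 = (1 + b ^ 2) / 2 := Real.sq_sqrt (by positivity)
  have hr0 : 0 < r := Real.sqrt_pos.2 (by positivity)
  have har : a ≤ r := by nlinarith
  have e : axialMap a b = axialMap r b * axialMap (a / r) 1 := by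
    rw [axialMap_mul, mul_div_cancel₀ _ hr0.ne', mul_one]
  rw [e, tensorMap_mul]
  exact (isPositiveMap_tensorMap_axialMap_of_eq hr0.le hb hb' (by linarith)).comp
    (isPositiveMap_tensorMap_dephasing (by positivity) ((div_le_one hr0).2 har))

/-! ### The decay factors and their convexity inequalities -/

/-- The factor `e^{-αt} cosh^α t` of the first two Bloch components. -/
noncomputable def transverseFactor (α t : ℝ) : ℝ := Real.exp (-α * t) * Real.cosh t ^ α

/-- The factor `e^{-2αt}` of the third Bloch component. -/
noncomputable def longitudinalFactor (α t : ℝ) : ℝ := Real.exp (-2 * α * t)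

theorem qubitMap_eq (α t : ℝ) :
    qubitMap α t = axialMap (transverseFactor α t) (longitudinalFactor α t) :=
  qubitMap_eq_axialMap α t

theorem transverseFactor_pos (α t : ℝ) : 0 < transverseFactor α t :=
  mul_pos (Real.exp_pos _) (Real.rpow_pos_of_pos (Real.cosh_pos t) _)

theorem longitudinalFactor_pos (α t : ℝ) : 0 < longitudinalFactor α t := Real.exp_pos _

theorem transverseFactor_eq_rpow (α t : ℝ) :
    transverseFactor α t = ((1 + Real.exp (-2 * t)) / 2) ^ α := by
  have h : (1 + Real.exp (-2 * t)) / 2 = Real.exp (-t) * Real.cosh t := by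
    rw [Real.cosh_eq, mul_div_assoc', mul_add, ← Real.exp_add, ← Real.exp_add]
    rw [neg_add_cancel, Real.exp_zero, show -t + -t = -2 * t by ring]
  rw [h, Real.mul_rpow (Real.exp_pos _).le (Real.cosh_pos t).le, ← Real.exp_mul, transverseFactor]
  ring_nf

theorem longitudinalFactor_eq_rpow (α t : ℝ) :
    longitudinalFactor α t = Real.exp (-2 * t) ^ α := by
  rw [← Real.exp_mul, longitudinalFactor]
  ring_nf

theorem transverseFactor_zero (α : ℝ) : transverseFactor α 0 = 1 := by simp [transverseFactor]

theorem longitudinalFactor_zero (α : ℝ) : longitudinalFactor α 0 = 1 := by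
  simp [longitudinalFactor]

theorem antitone_transverseFactor {α : ℝ} (hα : 0 ≤ α) : Antitone (transverseFactor α) := by
  intro s t hst
  simp only [transverseFactor_eq_rpow]
  have : Real.exp (-2 * t) ≤ Real.exp (-2 * s) := Real.exp_le_exp.2 (by linarith)
  exact Real.rpow_le_rpow (by positivity) (by linarith) hα

theorem antitone_longitudinalFactor {α : ℝ} (hα : 0 ≤ α) : Antitone (longitudinalFactor α) := by
  intro s t hst
  exact Real.exp_le_exp.2 (by nlinarith)

theorem two_mul_transverseFactor_sq_le {α : ℝ} (hα : 1 / 2 ≤ α) (t : ℝ) :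
    2 * transverseFactor α t ^ 2 ≤ 1 + longitudinalFactor α t ^ 2 := by
  have hx := Real.exp_pos (-2 * t)
  rw [transverseFactor_eq_rpow, longitudinalFactor_eq_rpow, ← Real.rpow_natCast,
    ← Real.rpow_mul (by positivity), ← Real.rpow_natCast, ← Real.rpow_mul (by positivity)]
  have h := (convexOn_rpow (p := α * 2) (by linarith)).2 (Set.mem_Ici.2 zero_le_one)
    (Set.mem_Ici.2 hx.le) (by norm_num : (0 : ℝ) ≤ 1 / 2) (by norm_num : (0 : ℝ) ≤ 1 / 2)
    (by norm_num)
  simp only [smul_eq_mul, mul_one, Real.one_rpow] at h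
  rw [show (1 + Real.exp (-2 * t)) / 2 = 1 / 2 + 1 / 2 * Real.exp (-2 * t) by ring]
  push_cast
  linarith

theorem one_add_longitudinalFactor_lt {α : ℝ} (h0 : 0 < α) (h1 : α < 1) {t : ℝ} (ht : 0 < t) :
    1 + longitudinalFactor α t < 2 * transverseFactor α t := by
  have hx := Real.exp_pos (-2 * t)
  have hx1 : (1 : ℝ) ≠ Real.exp (-2 * t) := by
    have : Real.exp (-2 * t) < 1 := by rw [← Real.exp_zero]; exact Real.exp_lt_exp.2 (by linarith)
    exact this.ne'
  rw [transverseFactor_eq_rpow, longitudinalFactor_eq_rpow]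
  have h := (Real.strictConcaveOn_rpow h0 h1).2 (Set.mem_Ici.2 zero_le_one)
    (Set.mem_Ici.2 hx.le) hx1 (by norm_num : (0 : ℝ) < 1 / 2) (by norm_num : (0 : ℝ) < 1 / 2)
    (by norm_num)
  simp only [smul_eq_mul, mul_one, Real.one_rpow] at h
  rw [show (1 + Real.exp (-2 * t)) / 2 = 1 / 2 + 1 / 2 * Real.exp (-2 * t) by ring]
  linarith

/-! ### The Bell test and the failures of positivity -/

/-- The (unnormalized) projection onto the maximally entangled vector `e₀ ⊗ e₀ + e₁ ⊗ e₁`. -/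
def bellMatrix : Matrix (Fin 2 × Fin 2) (Fin 2 × Fin 2) ℂ :=
  Matrix.vecMulVec (fun p => if p.1 = p.2 then 1 else 0) (fun p => if p.1 = p.2 then 1 else 0)

theorem posSemidef_bellMatrix : bellMatrix.PosSemidef := by
  have := Matrix.posSemidef_vecMulVec_self_star
    (fun p : Fin 2 × Fin 2 => if p.1 = p.2 then (1 : ℂ) else 0)
  convert this using 1
  unfold bellMatrix
  congr 1
  ext p
  simp [apply_ite]

/-- The image of the Bell projection, evaluated on e₀ ⊗ e₀ - e₁ ⊗ e₁, gives 1 + bb' - 2aa'. With a'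
= b' = 1 this also tests complete positivity. -/
theorem le_of_isPositiveMap_tensorMap_axialMap {a b a' b' : ℝ}
    (h : IsPositiveMap (tensorMap (axialMap a b) (axialMap a' b'))) :
    2 * (a * a') ≤ 1 + b * b' := by
  have h1 := (h _ posSemidef_bellMatrix).dotProduct_mulVec_nonneg
    (fun p => if p.1 = p.2 then (if p.1 = 0 then 1 else -1) else 0)
  simp [tensorMap, bellMatrix, dotProduct, Matrix.mulVec, Fintype.sum_prod_type,
    Fin.sum_univ_two, Matrix.vecMulVec_apply, axialMap_apply, Matrix.single_apply] at h1
  rw [Complex.le_def] at h1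
  have h2 := h1.1
  norm_num at h2
  linarith

theorem not_isCompletelyPositiveMap_axialMap {a b : ℝ} (h : 1 + b < 2 * a) :
    ¬ IsCompletelyPositiveMap (axialMap a b) := by
  intro hcp
  have h2 := hcp 2
  rw [← Module.End.one_eq_id, ← axialMap_one] at h2
  have := le_of_isPositiveMap_tensorMap_axialMap h2
  linarith

theorem propagator_qubitMap (α t s : ℝ) :
    propagator (qubitMap α) t s =
      axialMap (transverseFactor α t / transverseFactor α s)
        (longitudinalFactor α t / longitudinalFactor α s) := by
  rw [propagator, qubitMap_eq, qubitMap_eq, axialMap_mul_inverse (transverseFactor_pos α s).ne'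
    (longitudinalFactor_pos α s).ne']

theorem isUnit_qubitMap (α t : ℝ) : IsUnit (qubitMap α t) := by
  rw [qubitMap_eq]
  exact isUnit_axialMap (transverseFactor_pos α t).ne' (longitudinalFactor_pos α t).ne'

theorem isPositiveMap_propagator_qubitMap {α : ℝ} (hα : 0 ≤ α) {s t : ℝ} (hst : s ≤ t) :
    IsPositiveMap (propagator (qubitMap α) t s) := by
  rw [propagator_qubitMap]
  have h1 := transverseFactor_pos α s
  have h2 := transverseFactor_pos α t
  have h3 := longitudinalFactor_pos α s
  have h4 := longitudinalFactor_pos α t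
  exact isPositiveMap_axialMap (by positivity)
    ((div_le_one h1).2 (antitone_transverseFactor hα hst)) (by positivity)
    ((div_le_one h3).2 (antitone_longitudinalFactor hα hst))

theorem exists_not_isPositiveMap_tensorMap_propagator {α : ℝ} (h0 : 1 / 2 ≤ α) (h1 : α ≤ 1) :
    ∃ s t : ℝ, 0 ≤ s ∧ s < t ∧ ¬ IsPositiveMap
      (tensorMap (propagator (qubitMap α) t s) (propagator (qubitMap α) t s)) := by
  have hlt : Real.log 10 < Real.log 20 := Real.log_lt_log (by norm_num) (by norm_num)
  -- Here x drops from 1/10 to 1/20, so the squared ratios are (441/484)^α and (1/4)^α. For 1/2 ≤ α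
  -- ≤ 1 the first is at least 441/484 and the second at most 1/2, and 2 · 441/484 > 3/2.
  refine ⟨Real.log 10 / 2, Real.log 20 / 2, by positivity, by linarith, fun h => ?_⟩
  have e (y : ℝ) (hy : 0 < y) : Real.exp (-2 * (Real.log y / 2)) = y⁻¹ := by
    rw [← Real.exp_log (inv_pos.2 hy), Real.log_inv]
    ring_nf
  rw [propagator_qubitMap] at h
  have h2 := le_of_isPositiveMap_tensorMap_axialMap h
  rw [transverseFactor_eq_rpow, transverseFactor_eq_rpow, longitudinalFactor_eq_rpow,
    longitudinalFactor_eq_rpow, e _ (by norm_num), e _ (by norm_num),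
    ← Real.div_rpow (by norm_num) (by norm_num), ← Real.div_rpow (by norm_num) (by norm_num),
    ← Real.mul_rpow (by norm_num) (by norm_num), ← Real.mul_rpow (by norm_num) (by norm_num)] at h2
  have h3 := Real.rpow_le_rpow_of_exponent_ge (x := (441 / 484 : ℝ)) (by norm_num) (by norm_num) h1
  have h4 := Real.rpow_le_rpow_of_exponent_ge (x := (1 / 4 : ℝ)) (by norm_num) (by norm_num) h0
  have h5 : (1 / 4 : ℝ) ^ (1 / 2 : ℝ) = 1 / 2 := by
    rw [← Real.sqrt_eq_rpow, show (1 / 4 : ℝ) = (1 / 2) ^ 2 by norm_num,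
      Real.sqrt_sq (by norm_num)]
  norm_num at h2 h3 h4 h5
  linarith

/-! ### Trace norm from the spectrum; perturbations of the identity -/

theorem roots_prod_X_sub_C_ofReal {ι : Type*} [Fintype ι] (f : ι → ℝ) :
    (∏ i, (Polynomial.X - Polynomial.C (f i : ℂ))).roots =
      Finset.univ.val.map (fun i => (f i : ℂ)) := by
  rw [Polynomial.roots_prod _ _
    (Finset.prod_ne_zero_iff.2 fun i _ => Polynomial.X_sub_C_ne_zero _)]
  simp

/-- The two families have the same multiset of roots, so no matching of their indices is needed. -/
theorem sum_eq_of_prod_X_sub_C_eq {ι κ : Type*} [Fintype ι] [Fintype κ] {f : ι → ℝ} {g : κ → ℝ}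
    (h : ∏ i, (Polynomial.X - Polynomial.C (f i : ℂ)) =
      ∏ j, (Polynomial.X - Polynomial.C (g j : ℂ))) (φ : ℝ → ℝ) :
    ∑ i, φ (f i) = ∑ j, φ (g j) := by
  have h1 : Finset.univ.val.map (fun i => (f i : ℂ)) = Finset.univ.val.map (fun j => (g j : ℂ)) := by
    have := congrArg Polynomial.roots h
    rwa [roots_prod_X_sub_C_ofReal, roots_prod_X_sub_C_ofReal] at this
  have h2 := congrArg (Multiset.map (fun x : ℂ => φ x.re)) h1
  simp only [Multiset.map_map, Function.comp_def, Complex.ofReal_re] at h2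
  exact congrArg Multiset.sum h2

/-- The trace norm of a Hermitian matrix is the sum of the absolute values of its eigenvalues,
which may be read off from any factorization of the characteristic polynomial. -/
theorem traceNorm_eq_sum_abs {n ι : Type*} [Fintype n] [DecidableEq n] [Fintype ι]
    {A : Matrix n n ℂ} (hA : A.IsHermitian) {μ : ι → ℝ}
    (h : A.charpoly = ∏ i, (Polynomial.X - Polynomial.C (μ i : ℂ))) :
    traceNorm A = ∑ i, |μ i| := by
  -- By hermiticity this is A², whose eigenvalues are the squares of those of A; the square roots
  -- then return absolute values.
  have hsq : A.conjTranspose * A = cfc (fun x : ℝ => x ^ 2) A := by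
    rw [cfc_pow_id (R := ℝ) A 2 hA.isSelfAdjoint, hA.eq, sq]
  have h1 := (Matrix.isHermitian_conjTranspose_mul_self A).charpoly_eq
  have h2 := congrArg Matrix.charpoly hsq
  rw [h1, hA.charpoly_cfc_eq] at h2
  refine (sum_eq_of_prod_X_sub_C_eq h2 Real.sqrt).trans ?_
  refine (Finset.sum_congr rfl fun i _ => Real.sqrt_sq_eq_abs _).trans ?_
  exact sum_eq_of_prod_X_sub_C_eq (hA.charpoly_eq.symm.trans h) (|·|)

theorem exists_posSemidef_one_add_smul {n : Type*} [Fintype n] [DecidableEq n]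
    {A : Matrix n n ℂ} (hA : A.IsHermitian) :
    ∃ r : ℝ, 0 < r ∧ ∀ s : ℝ, |s| ≤ r → (1 + (s : ℂ) • A).PosSemidef := by
  obtain ⟨M, hM0, hM⟩ : ∃ M : ℝ, 0 < M ∧ ∀ i, |hA.eigenvalues i| ≤ M := by
    refine ⟨1 + ∑ i, |hA.eigenvalues i|, by positivity, fun i => ?_⟩
    have := Finset.single_le_sum (f := fun i => |hA.eigenvalues i|)
      (fun _ _ => abs_nonneg _) (Finset.mem_univ i)
    linarith
  refine ⟨M⁻¹, inv_pos.2 hM0, fun s hs => ?_⟩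
  have hD : (Matrix.diagonal fun i => (1 + (s : ℂ) * hA.eigenvalues i)).PosSemidef := by
    refine Matrix.PosSemidef.diagonal fun i => ?_
    have h1 : |s * hA.eigenvalues i| ≤ 1 := by
      rw [abs_mul, ← inv_mul_cancel₀ hM0.ne']
      exact mul_le_mul hs (hM i) (abs_nonneg _) (by positivity)
    have h2 : 0 ≤ 1 + s * hA.eigenvalues i := by linarith [(abs_le.1 h1).1]
    have h3 : (0 : ℂ) ≤ ((1 + s * hA.eigenvalues i : ℝ) : ℂ) := Complex.zero_le_real.2 h2
    simpa using h3
  have h3 := hD.mul_mul_conjTranspose_same (hA.eigenvectorUnitary : Matrix n n ℂ)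
  convert h3 using 1
  have hsplit : (Matrix.diagonal fun i => (1 + (s : ℂ) * hA.eigenvalues i)) =
      1 + (s : ℂ) • Matrix.diagonal (RCLike.ofReal ∘ hA.eigenvalues) := by
    ext i j
    by_cases hij : i = j <;> simp [hij]
  have hU : (hA.eigenvectorUnitary : Matrix n n ℂ) *
      (hA.eigenvectorUnitary : Matrix n n ℂ).conjTranspose = 1 :=
    Unitary.mul_star_self_of_mem hA.eigenvectorUnitary.2
  have hspec := hA.spectral_theorem
  rw [Unitary.conjStarAlgAut_apply] at hspec
  rw [hsplit, mul_add, mul_one, add_mul, hU, Matrix.mul_smul, Matrix.smul_mul]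
  congr 2

/-! ### Information flow for one qubit -/

theorem hasDerivAt_longitudinalFactor (α t : ℝ) :
    HasDerivAt (longitudinalFactor α) (-2 * α * longitudinalFactor α t) t := by
  have h := ((hasDerivAt_id t).const_mul (-2 * α)).exp
  refine h.congr_deriv ?_
  simp only [longitudinalFactor, id]
  ring

theorem hasDerivAt_transverseFactor (α t : ℝ) :
    HasDerivAt (transverseFactor α)
      (α * (Real.sinh t / Real.cosh t - 1) * transverseFactor α t) t := by
  have hc := Real.cosh_pos t
  have h := (((hasDerivAt_id t).const_mul (-α)).exp).mul
    ((Real.hasDerivAt_cosh t).rpow_const (p := α) (Or.inl hc.ne'))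
  refine h.congr_deriv ?_
  simp only [transverseFactor, Real.rpow_sub_one hc.ne', id]
  field_simp
  ring

theorem traceNorm_traceless (z : ℝ) (w : ℂ) :
    traceNorm !![(z : ℂ), w; star w, -(z : ℂ)] = 2 * Real.sqrt (z ^ 2 + ‖w‖ ^ 2) := by
  have hH : (!![(z : ℂ), w; star w, -(z : ℂ)]).IsHermitian := by
    ext i j
    fin_cases i <;> fin_cases j <;> simp
  have hr : (((Real.sqrt (z ^ 2 + ‖w‖ ^ 2) : ℝ) : ℂ)) ^ 2 = z ^ 2 + w * star w := by
    rw [← Complex.ofReal_pow, Real.sq_sqrt (by positivity), Complex.star_def, Complex.mul_conj,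
      Complex.normSq_eq_norm_sq]
    push_cast
    ring
  generalize hR : Real.sqrt (z ^ 2 + ‖w‖ ^ 2) = R at hr ⊢
  have hR0 : 0 ≤ R := hR ▸ Real.sqrt_nonneg _
  rw [traceNorm_eq_sum_abs hH (μ := ![R, -R])]
  · simp [Fin.sum_univ_two, abs_of_nonneg hR0]
    ring
  · have hr' := congrArg (Polynomial.C (R := ℂ)) hr
    simp only [map_pow, map_add, map_mul] at hr'
    simp [Matrix.charpoly, Matrix.charmatrix, Matrix.det_fin_two, Fin.prod_univ_two]
    simp at hr'
    linear_combination hr'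

theorem exists_hasInformationFlow_qubitMap {α : ℝ} (hα : 0 ≤ α)
    {ρ₁ ρ₂ : Matrix (Fin 2) (Fin 2) ℂ} (h₁ : IsDensityMatrix ρ₁) (h₂ : IsDensityMatrix ρ₂) (t : ℝ) :
    ∃ v : ℝ, v ≤ 0 ∧ HasInformationFlow (qubitMap α) ρ₁ ρ₂ t v := by
  have hH : (ρ₁ - ρ₂).IsHermitian := h₁.1.1.sub h₂.1.1
  have htr : (ρ₁ - ρ₂).trace = 0 := by rw [Matrix.trace_sub, h₁.2, h₂.2, sub_self]
  unfold HasInformationFlow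
  generalize ρ₁ - ρ₂ = D at hH htr ⊢
  obtain ⟨z, hz⟩ : ∃ z : ℝ, (z : ℂ) = D 0 0 := ⟨_, Complex.conj_eq_iff_re.1 (hH.apply 0 0)⟩
  have hD (a b : ℝ) : axialMap a b D =
      !![((b * z : ℝ) : ℂ), a * D 0 1; star (a * D 0 1), -((b * z : ℝ) : ℂ)] := by
    have h11 : D 1 1 = -z := by
      rw [Matrix.trace_fin_two, ← hz] at htr
      linear_combination htr
    have h10 := hH.apply 1 0
    ext i j
    fin_cases i <;> fin_cases j <;> simp [axialMap_apply, h11, ← hz, ← h10] <;> ring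
  have hN (τ : ℝ) : traceNorm (qubitMap α τ D) = 2 * Real.sqrt
      (z ^ 2 * longitudinalFactor α τ ^ 2 + ‖D 0 1‖ ^ 2 * transverseFactor α τ ^ 2) := by
    rw [qubitMap_eq, hD, traceNorm_traceless, norm_mul, Complex.norm_real, mul_pow, mul_pow,
      Real.norm_eq_abs, sq_abs]
    ring_nf
  simp only [hN]
  have hb := longitudinalFactor_pos α t
  have ha := transverseFactor_pos α t
  -- The square root is not differentiable at 0. As both factors are positive, a zero radicand
  -- forces z and w to vanish, so the norm is identically 0.
  by_cases h0 : z ^ 2 * longitudinalFactor α t ^ 2 + ‖D 0 1‖ ^ 2 * transverseFactor α t ^ 2 = 0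
  · have hz0 : z ^ 2 = 0 := by
      by_contra hne
      have : 0 < z ^ 2 := lt_of_le_of_ne (sq_nonneg z) (Ne.symm hne)
      have : 0 < z ^ 2 * longitudinalFactor α t ^ 2 := by positivity
      have : 0 ≤ ‖D 0 1‖ ^ 2 * transverseFactor α t ^ 2 := by positivity
      linarith
    have hw0 : ‖D 0 1‖ ^ 2 = 0 := by
      rw [hz0, zero_mul, zero_add] at h0
      exact (mul_eq_zero.1 h0).resolve_right (by positivity)
    refine ⟨0, le_rfl, ?_⟩
    simp only [hz0, hw0, zero_mul, add_zero, Real.sqrt_zero, mul_zero]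
    exact hasDerivWithinAt_const _ _ _
  · have hder := (((((hasDerivAt_longitudinalFactor α t).pow 2).const_mul (z ^ 2)).add
      (((hasDerivAt_transverseFactor α t).pow 2).const_mul (‖D 0 1‖ ^ 2))).sqrt h0).const_mul 2
    refine ⟨_, ?_, hder.hasDerivWithinAt⟩
    have hth : Real.sinh t / Real.cosh t - 1 ≤ 0 := by
      rw [sub_nonpos, div_le_one (Real.cosh_pos t)]
      exact (Real.sinh_lt_cosh t).le
    refine mul_nonpos_of_nonneg_of_nonpos zero_le_two
      (div_nonpos_of_nonpos_of_nonneg (add_nonpos ?_ ?_) (by positivity))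
    · refine mul_nonpos_of_nonneg_of_nonpos (sq_nonneg z)
        (mul_nonpos_of_nonneg_of_nonpos (by positivity) ?_)
      nlinarith
    · refine mul_nonpos_of_nonneg_of_nonpos (sq_nonneg _)
        (mul_nonpos_of_nonneg_of_nonpos (by positivity) ?_)
      exact mul_nonpos_of_nonpos_of_nonneg (mul_nonpos_of_nonneg_of_nonpos hα hth) ha.le

/-! ### Back-flow of information for two qubits -/

/-- The two-qubit observable
`u (σ₁ ⊗ 1 + 1 ⊗ σ₁) + v σ₁ ⊗ σ₁ + w σ₂ ⊗ σ₂ + z σ₃ ⊗ σ₃`. -/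
def correlationMatrix (u v w z : ℝ) : Matrix (Fin 2 × Fin 2) (Fin 2 × Fin 2) ℂ :=
  (u : ℂ) • (pauli1 ⊗ₖ 1 + 1 ⊗ₖ pauli1) + (v : ℂ) • (pauli1 ⊗ₖ pauli1) +
    (w : ℂ) • (pauli2 ⊗ₖ pauli2) + (z : ℂ) • (pauli3 ⊗ₖ pauli3)

theorem axialMap_pauli1 (a b : ℝ) : axialMap a b pauli1 = (a : ℂ) • pauli1 := by
  ext i j; fin_cases i <;> fin_cases j <;> simp [axialMap_apply, pauli1]

theorem axialMap_pauli2 (a b : ℝ) : axialMap a b pauli2 = (a : ℂ) • pauli2 := by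
  ext i j; fin_cases i <;> fin_cases j <;> simp [axialMap_apply, pauli2]

theorem axialMap_pauli3 (a b : ℝ) : axialMap a b pauli3 = (b : ℂ) • pauli3 := by
  ext i j; fin_cases i <;> fin_cases j <;> simp [axialMap_apply, pauli3] <;> ring

theorem axialMap_one_matrix (a b : ℝ) : axialMap a b 1 = 1 := by
  ext i j; fin_cases i <;> fin_cases j <;> simp [axialMap_apply] <;> ring

theorem tensorMap_axialMap_correlationMatrix (a b u v w z : ℝ) :
    tensorMap (axialMap a b) (axialMap a b) (correlationMatrix u v w z) =
      correlationMatrix (u * a) (v * a ^ 2) (w * a ^ 2) (z * b ^ 2) := by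
  simp only [correlationMatrix, map_add, map_smul, tensorMap_kronecker, axialMap_pauli1,
    axialMap_pauli2, axialMap_pauli3, axialMap_one_matrix, Matrix.smul_kronecker,
    Matrix.kronecker_smul]
  match_scalars <;> ring

theorem smul_correlationMatrix (r u v w z : ℝ) :
    (r : ℂ) • correlationMatrix u v w z = correlationMatrix (r * u) (r * v) (r * w) (r * z) := by
  simp only [correlationMatrix]
  match_scalars <;> ring

theorem isHermitian_pauli1 : pauli1.IsHermitian := by
  ext i j; fin_cases i <;> fin_cases j <;> simp [pauli1]

theorem isHermitian_pauli2 : pauli2.IsHermitian := by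
  ext i j; fin_cases i <;> fin_cases j <;> simp [pauli2]

theorem isHermitian_pauli3 : pauli3.IsHermitian := by
  ext i j; fin_cases i <;> fin_cases j <;> simp [pauli3]

theorem isHermitian_correlationMatrix (u v w z : ℝ) : (correlationMatrix u v w z).IsHermitian := by
  simp [Matrix.IsHermitian, correlationMatrix, Matrix.conjTranspose_add, Matrix.conjTranspose_smul,
    Matrix.conjTranspose_kronecker, isHermitian_pauli1.eq, isHermitian_pauli2.eq,
    isHermitian_pauli3.eq]

theorem trace_correlationMatrix (u v w z : ℝ) : (correlationMatrix u v w z).trace = 0 := by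
  simp [correlationMatrix, Matrix.trace_kronecker, Matrix.trace_add, Matrix.trace_smul, pauli1,
    pauli2, pauli3, Matrix.trace_fin_two]

/-- The observable commutes with σ₁ ⊗ σ₁. On the +1 eigenspace σ₂ ⊗ σ₂ = -σ₃ ⊗ σ₃, which
anticommutes with σ₁ ⊗ 1 + 1 ⊗ σ₁, of square 4; this gives v ± g. On the -1 eigenspace σ₂ ⊗ σ₂ = σ₃
⊗ σ₃ and the local term vanishes. -/
theorem charpoly_correlationMatrix (u v w z : ℝ) {g : ℝ} (hg : g ^ 2 = 4 * u ^ 2 + (z - w) ^ 2) :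
    (correlationMatrix u v w z).charpoly = ∏ i, (Polynomial.X -
      Polynomial.C (((![v + g, v - g, -v + (w + z), -v - (w + z)] : Fin 4 → ℝ) i : ℝ) : ℂ)) := by
  have hm : Matrix.reindex finProdFinEquiv finProdFinEquiv (correlationMatrix u v w z) =
      !![(z : ℂ), u, u, v - w; u, -z, v + w, u; u, v + w, -z, u; v - w, u, u, z] := by
    ext i j
    fin_cases i <;> fin_cases j <;>
      simp [correlationMatrix, finProdFinEquiv, Fin.divNat, Fin.modNat, pauli1, pauli2, pauli3] <;> ring
  rw [← Matrix.charpoly_reindex finProdFinEquiv, hm]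
  have hg' : (Polynomial.C (g : ℂ)) ^ 2 = 4 * Polynomial.C (u : ℂ) ^ 2 +
      (Polynomial.C (z : ℂ) - Polynomial.C (w : ℂ)) ^ 2 := by
    have : (g : ℂ) ^ 2 = 4 * (u : ℂ) ^ 2 + ((z : ℂ) - w) ^ 2 := by exact_mod_cast hg
    have h4 : (Polynomial.C (4 : ℂ)) = 4 := map_ofNat _ 4
    rw [← map_pow, this]
    simp [h4]
  simp [Matrix.charpoly, Matrix.charmatrix, Matrix.det_succ_row_zero, Fin.sum_univ_succ,
    Fin.prod_univ_succ, Fin.succAbove]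
  linear_combination ((Polynomial.X + Polynomial.C (v : ℂ)) ^ 2 -
    (Polynomial.C (w : ℂ) + Polynomial.C (z : ℂ)) ^ 2) * hg'

theorem traceNorm_correlationMatrix (u v w z : ℝ) :
    traceNorm (correlationMatrix u v w z) =
      |v + Real.sqrt (4 * u ^ 2 + (z - w) ^ 2)| + |v - Real.sqrt (4 * u ^ 2 + (z - w) ^ 2)| +
        |-v + (w + z)| + |-v - (w + z)| := by
  rw [traceNorm_eq_sum_abs (isHermitian_correlationMatrix u v w z)
    (charpoly_correlationMatrix u v w z (Real.sq_sqrt (by positivity)))]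
  simp [Fin.sum_univ_succ]
  ring

/-- Only v - √(4u² + (z - w)²) can be negative. The trace being zero, the norm is twice its absolute
value. -/
theorem traceNorm_correlationMatrix_of_lt {u v w z : ℝ} (h1 : |w + z| ≤ -v)
    (h2 : -v ≤ Real.sqrt (4 * u ^ 2 + (z - w) ^ 2)) :
    traceNorm (correlationMatrix u v w z) =
      2 * Real.sqrt (4 * u ^ 2 + (z - w) ^ 2) - 2 * v := by
  obtain ⟨h3, h4⟩ := abs_le.1 h1
  rw [traceNorm_correlationMatrix, abs_of_nonneg (by linarith), abs_of_nonpos (by linarith),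
    abs_of_nonneg (by linarith), abs_of_nonneg (by linarith)]
  ring

/-- Perturb the maximally mixed state by ±rA, with r small enough to preserve positivity. -/
theorem exists_isDensityMatrix_sub_eq {n : Type*} [Fintype n] [DecidableEq n] [Nonempty n]
    {A : Matrix n n ℂ} (hA : A.IsHermitian) (htr : A.trace = 0) :
    ∃ r : ℝ, 0 < r ∧ ∃ ρ₁ ρ₂ : Matrix n n ℂ,
      IsDensityMatrix ρ₁ ∧ IsDensityMatrix ρ₂ ∧ ρ₁ - ρ₂ = (r : ℂ) • A := by
  obtain ⟨r, hr, h⟩ := exists_posSemidef_one_add_smul hA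
  have hn : (0 : ℝ) < Fintype.card n := by exact_mod_cast Fintype.card_pos
  have hd (s : ℝ) (hs : |s| ≤ r) :
      IsDensityMatrix ((((Fintype.card n : ℝ)⁻¹ : ℝ) : ℂ) • (1 + (s : ℂ) • A)) := by
    refine ⟨(h s hs).smul (Complex.zero_le_real.2 (by positivity)), ?_⟩
    rw [Matrix.trace_smul, Matrix.trace_add, Matrix.trace_smul, htr, Matrix.trace_one]
    simp
  refine ⟨2 * r / Fintype.card n, by positivity, _, _, hd r (abs_of_pos hr).le,
    hd (-r) (by rw [abs_neg, abs_of_pos hr]), ?_⟩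
  rw [← smul_sub]
  match_scalars <;> ring

/-- For these initial states the smallest eigenvalue of the evolved difference, which is the only
negative one, decreases at the time `log 10`. -/
theorem exists_hasInformationFlow_pos {α : ℝ} (hα : 0 < α) :
    ∃ ρ₁ ρ₂ : Matrix (Fin 2 × Fin 2) (Fin 2 × Fin 2) ℂ,
      IsDensityMatrix ρ₁ ∧ IsDensityMatrix ρ₂ ∧ ∃ t : ℝ, 0 ≤ t ∧ ∃ v : ℝ, 0 < v ∧
        HasInformationFlow (fun τ => tensorMap (qubitMap α τ) (qubitMap α τ)) ρ₁ ρ₂ t v := by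
  obtain ⟨t, ht⟩ : ∃ t, t = Real.log 10 := ⟨_, rfl⟩
  have ht0 : 0 ≤ t := ht ▸ Real.log_nonneg (by norm_num)
  have htanh : Real.sinh t / Real.cosh t = 99 / 101 := by
    rw [ht, Real.sinh_log (by norm_num), Real.cosh_log (by norm_num)]
    norm_num
  have ha := transverseFactor_pos α t
  have hb := longitudinalFactor_pos α t
  obtain ⟨A, hA⟩ : ∃ A : ℝ → ℝ, A = fun τ => transverseFactor α τ / transverseFactor α t :=
    ⟨_, rfl⟩
  obtain ⟨B, hB⟩ : ∃ B : ℝ → ℝ, B = fun τ => longitudinalFactor α τ / longitudinalFactor α t :=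
    ⟨_, rfl⟩
  have hA1 : A t = 1 := by rw [hA]; exact div_self ha.ne'
  have hB1 : B t = 1 := by rw [hB]; exact div_self hb.ne'
  have hA' : HasDerivAt A (-(2 / 101) * α) t := by
    rw [hA]
    refine ((hasDerivAt_transverseFactor α t).div_const _).congr_deriv ?_
    rw [htanh]
    field_simp
    ring
  have hB' : HasDerivAt B (-2 * α) t := by
    rw [hB]
    refine ((hasDerivAt_longitudinalFactor α t).div_const _).congr_deriv ?_
    field_simp
  -- The divisors undo the decay up to time t, where the coefficients become (2, -9/2, 7/2, 1/2) up
  -- to r. This makes g = 5 and the spectrum 1/2, -19/2, 17/2, 1/2.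
  obtain ⟨r, hr, ρ₁, ρ₂, h₁, h₂, hρ⟩ := exists_isDensityMatrix_sub_eq
    (isHermitian_correlationMatrix (2 / transverseFactor α t)
      (-(9 / 2) / transverseFactor α t ^ 2) (7 / 2 / transverseFactor α t ^ 2)
      (1 / 2 / longitudinalFactor α t ^ 2)) (trace_correlationMatrix _ _ _ _)
  have hev (τ : ℝ) : tensorMap (qubitMap α τ) (qubitMap α τ) (ρ₁ - ρ₂) =
      correlationMatrix (r * (2 * A τ)) (r * (-(9 / 2) * A τ ^ 2)) (r * (7 / 2 * A τ ^ 2))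
        (r * (1 / 2 * B τ ^ 2)) := by
    rw [hρ, smul_correlationMatrix, qubitMap_eq, tensorMap_axialMap_correlationMatrix, hA, hB]
    congr 1 <;> field_simp
  obtain ⟨S, hS⟩ : ∃ S : ℝ → ℝ,
      S = fun τ => 16 * A τ ^ 2 + (1 / 2 * B τ ^ 2 - 7 / 2 * A τ ^ 2) ^ 2 := ⟨_, rfl⟩
  have hS1 : S t = 25 := by rw [hS]; simp only [hA1, hB1]; norm_num
  have hsqrt1 : Real.sqrt (S t) = 5 := by
    rw [hS1, show (25 : ℝ) = 5 ^ 2 by norm_num, Real.sqrt_sq (by norm_num)]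
  have hS' : HasDerivAt S (32 * (-(2 / 101) * α) +
      -6 * (-2 * α - 7 * (-(2 / 101) * α))) t := by
    rw [hS]
    refine (((hA'.pow 2).const_mul 16).add
      ((((hB'.pow 2).const_mul (1 / 2)).sub ((hA'.pow 2).const_mul (7 / 2))).pow 2)).congr_deriv ?_
    simp [hA1, hB1]
    ring
  have hroot (τ : ℝ) : Real.sqrt (4 * (r * (2 * A τ)) ^ 2 +
      (r * (1 / 2 * B τ ^ 2) - r * (7 / 2 * A τ ^ 2)) ^ 2) = r * Real.sqrt (S τ) := by
    rw [hS, ← Real.sqrt_sq hr.le, ← Real.sqrt_mul (sq_nonneg r), Real.sqrt_sq hr.le]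
    congr 1
    ring
  have hder := (((hS'.sqrt (by rw [hS1]; norm_num)).const_mul 2).add
    ((hA'.pow 2).const_mul 9)).const_mul r
  have hcA := hA'.continuousAt
  have hcB := hB'.continuousAt
  have hcS := hS'.continuousAt
  -- At t the two comparisons are 4 < 9/2 and 9/2 < 5. Being strict, they persist nearby, so the
  -- closed form can be differentiated.
  have hE1 : ∀ᶠ τ in nhds t, 7 / 2 * A τ ^ 2 + 1 / 2 * B τ ^ 2 < 9 / 2 * A τ ^ 2 := by
    refine ContinuousAt.eventually_lt (by fun_prop) (by fun_prop) ?_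
    rw [hA1, hB1]
    norm_num
  have hE2 : ∀ᶠ τ in nhds t, 9 / 2 * A τ ^ 2 < Real.sqrt (S τ) := by
    refine ContinuousAt.eventually_lt (by fun_prop) (by fun_prop) ?_
    rw [hA1, hsqrt1]
    norm_num
  refine ⟨ρ₁, ρ₂, h₁, h₂, t, ht0, _, ?_, (hder.congr_of_eventuallyEq ?_).hasDerivWithinAt⟩
  -- The flow is r · 884α/505: the root contributes 1064α/505, and the slow decay of A costs only
  -- 180α/505.
  · refine mul_pos hr ?_
    rw [hsqrt1, hA1]
    norm_num
    linarith
  · filter_upwards [hE1, hE2] with τ hτ1 hτ2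
    rw [hev, traceNorm_correlationMatrix_of_lt, hroot]
    · simp only [Pi.add_apply, Pi.pow_apply]
      ring
    · rw [abs_of_nonneg (by positivity)]
      nlinarith
    · rw [hroot]
      nlinarith

theorem corollary3 (α : ℝ) (hα : α ∈ Set.Ico (1 / 2 : ℝ) 1) :
    -- `Λ_t` is positive, but not completely positive
    ((∀ t : ℝ, 0 ≤ t → IsPositiveMap (qubitMap α t)) ∧
      (∀ t : ℝ, 0 < t → ¬ IsCompletelyPositiveMap (qubitMap α t))) ∧
    -- `Λ_t` is P-divisible
    ((∀ s : ℝ, 0 ≤ s → IsUnit (qubitMap α s)) ∧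
      (∀ s t : ℝ, 0 ≤ s → s ≤ t →
        qubitMap α t = propagator (qubitMap α) t s * qubitMap α s ∧
        IsPositiveMap (propagator (qubitMap α) t s))) ∧
    -- `Λ_t ⊗ Λ_t` is positive
    (∀ t : ℝ, 0 ≤ t → IsPositiveMap (tensorMap (qubitMap α t) (qubitMap α t))) ∧
    -- the maps `Λ_{t,s} ⊗ Λ_{t,s}` are not all positive
    (¬ ∀ s t : ℝ, 0 ≤ s → s < t → IsPositiveMap
      (tensorMap (propagator (qubitMap α) t s) (propagator (qubitMap α) t s))) ∧
    -- no back-flow of information for `Λ_t`, but back-flow for `Λ_t ⊗ Λ_t`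
    ((∀ ρ₁ ρ₂ : Matrix (Fin 2) (Fin 2) ℂ, IsDensityMatrix ρ₁ → IsDensityMatrix ρ₂ →
        ∀ t : ℝ, 0 ≤ t → ∃ v : ℝ, v ≤ 0 ∧ HasInformationFlow (qubitMap α) ρ₁ ρ₂ t v) ∧
      (∃ ρ₁ ρ₂ : Matrix (Fin 2 × Fin 2) (Fin 2 × Fin 2) ℂ,
        IsDensityMatrix ρ₁ ∧ IsDensityMatrix ρ₂ ∧ ∃ t : ℝ, 0 ≤ t ∧ ∃ v : ℝ, 0 < v ∧
          HasInformationFlow (fun τ => tensorMap (qubitMap α τ) (qubitMap α τ)) ρ₁ ρ₂ t v)) := by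
  obtain ⟨h0, h1⟩ := hα
  have hpos : 0 < α := by linarith
  refine ⟨⟨fun t ht => ?_, fun t ht => ?_⟩, ⟨fun s _ => isUnit_qubitMap α s, fun s t _ hst =>
    ⟨?_, isPositiveMap_propagator_qubitMap hpos.le hst⟩⟩, fun t ht => ?_, fun h => ?_,
    fun ρ₁ ρ₂ h₁ h₂ t _ => exists_hasInformationFlow_qubitMap hpos.le h₁ h₂ t,
    exists_hasInformationFlow_pos hpos⟩
  · rw [qubitMap_eq]
    exact isPositiveMap_axialMap (transverseFactor_pos α t).le
      ((antitone_transverseFactor hpos.le ht).trans_eq (transverseFactor_zero α))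
      (longitudinalFactor_pos α t).le
      ((antitone_longitudinalFactor hpos.le ht).trans_eq (longitudinalFactor_zero α))
  · rw [qubitMap_eq]
    exact not_isCompletelyPositiveMap_axialMap (one_add_longitudinalFactor_lt hpos h1 ht)
  · rw [propagator, mul_assoc, Ring.inverse_mul_cancel _ (isUnit_qubitMap α s), mul_one]
  · rw [qubitMap_eq]
    exact isPositiveMap_tensorMap_axialMap (transverseFactor_pos α t).le
      (longitudinalFactor_pos α t).le
      ((antitone_longitudinalFactor hpos.le ht).trans_eq (longitudinalFactor_zero α))
      (two_mul_transverseFactor_sq_le h0 t)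
  · obtain ⟨s, t, hs, hst, hn⟩ := exists_not_isPositiveMap_tensorMap_propagator h0 h1.le
    exact hn (h s t hs hst)
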